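/- Let $r>0$ and let $S^3_r=\{X\in\mathbb R^4:\|X\|=r\}$ carry the Riemannian metric induced from $\mathbb R^4$, with geodesic distance $d(X,Y)=r\,\angle(X,Y)$. A regular geodesic tetrahedron of edge length $a>0$ in $S^3_r$ is an intersection $T$ of $S^3_r$ with four half-spaces $\{x:\langle n_i,x\rangle\ge 0\}$ whose interiors have a common point on $S^3_r$, together with four vertices $v_1,\dots,v_4\in T$ such that $\langle n_i,v_j\rangle=0$ for $i\neq j$ and $d(v_i,v_j)=a$ for $i\ne j$ (the four great 2-spheres carrying the faces are allowed to coincide). Put $a_{\max}=2\arctan(\sqrt2)\,r$. For $a_0>0$ let $T(a_0)\subset\mathbb R^3$ be a Euclidean regular tetrahedron of edge length $a_0$ centred at the origin (in a fixed orientation), and let $\varphi:\mathbb R^3\to S^3_r$, $\varphi(x)=\frac{r}{\sqrt{r^2+|x|^2}}(x,r)$, be the inverse of the central projection. Then: 1. $a_{\max}$ is the largest edge length of a regular geodesic tetrahedron in $S^3_r$. Moreover, for every $a_0>0$ the set $\varphi(T(a_0))$, with the images under $\varphi$ of the vertices of $T(a_0)$ as its vertices, is a regular geodesic tetrahedron of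 edge length $a(a_0)=2r\arctan\Bigl(\frac12\,\frac{a_0}{\sqrt{r^2+a_0^2/8}}\Bigr)$, and $a(a_0)\to a_{\max}$ as $a_0\to\infty$. 2. Every regular geodesic tetrahedron of edge length $a_{\max}$ has Riemannian volume $$V(r,a_{\max})=\pi^2r^3=\tfrac12\operatorname{Vol}(S^3_r).$$ This is also the limit of the volumes of $\varphi(T(a_0))$ as $a_0\to\infty$, and the value at $a=a_{\max}$ of the volume expression $$12\,r^3\int_0^{\tan(a/(2r))}\frac{t\arctan t}{(3-t^2)\sqrt{2-t^2}}\,dt .$$ -/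

import Mathlib

open Real Filter Topology MeasureTheory
open scoped ENNReal

noncomputable section

/-- Euclidean space `ℝ³`, the target of the central-projection chart. -/
abbrev E3 : Type := EuclideanSpace ℝ (Fin 3)

/-- Euclidean space `ℝ⁴`, the ambient space of the 3-sphere. -/
abbrev E4 : Type := EuclideanSpace ℝ (Fin 4)

/-- The 3-sphere `S³_r` of radius `r` centred at the origin of `ℝ⁴`. -/
def sphere3 (r : ℝ) : Set E4 := Metric.sphere (0 : E4) r

/-- The geodesic (great-circle) distance between two points of `S³_r`. -/
def geodesicDist (r : ℝ) (X Y : E4) : ℝ := r * InnerProductGeometry.angle X Y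

/-- `T` is a regular geodesic tetrahedron of edge length `a` in `S³_r` with vertices `v 0, …, v 3`:
the vertices are points of `T` at pairwise geodesic distance `a > 0`, and `T` is the intersection
of four closed half-spheres `{⟪n i, x⟫ ≥ 0}`, the `i`-th of which is bounded by a great 2-sphere
through the three vertices `v j`, `j ≠ i` (the `i`-th face), and which have a common interior
point. When the vertices are linearly independent, `T` is their geodesic convex hull; the four
great 2-spheres are also allowed to coincide. -/
structure IsRegularGeodesicTetrahedron (r a : ℝ) (v : Fin 4 → E4) (T : Set E4) : Prop where
  edge_pos : 0 < a
  vertex_mem : ∀ i, v i ∈ T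
  edge_eq : ∀ i j, i ≠ j → geodesicDist r (v i) (v j) = a
  faces : ∃ n : Fin 4 → E4,
    (∀ i j, i ≠ j → inner ℝ (n i) (v j) = 0) ∧
    (∃ x ∈ sphere3 r, ∀ i, 0 < inner ℝ (n i) x) ∧
    T = {x | x ∈ sphere3 r ∧ ∀ i, 0 ≤ inner ℝ (n i) x}

/-- The inverse of the central-projection (Cayley–Klein–Hilbert, gnomonic) chart
`(X¹, X², X³, X⁴) ↦ r (X¹, X², X³) / X⁴`; it maps `ℝ³` onto the open half `X⁴ > 0` of `S³_r`. -/
def chartInv (r : ℝ) (x : E3) : E4 :=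
  (r / √(r ^ 2 + ‖x‖ ^ 2)) • (!₂[x 0, x 1, x 2, r] : E4)

/-- The metric `g_{AB}(x) = ⟪∂_A φ, ∂_B φ⟫` that a parametrization `φ : ℝ³ → ℝ⁴` induces from the
Euclidean metric of `ℝ⁴`. -/
def inducedMetric (φ : E3 → E4) (x : E3) : Matrix (Fin 3) (Fin 3) ℝ :=
  Matrix.of fun A B => inner ℝ (fderiv ℝ φ x (EuclideanSpace.single A (1 : ℝ)))
    (fderiv ℝ φ x (EuclideanSpace.single B (1 : ℝ)))

/-- The Riemannian volume `∫ √|det g| dx` of the part of `A` parametrized by the injective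
parametrization `φ`. -/
def paramVolume (φ : E3 → E4) (A : Set E4) : ℝ≥0∞ :=
  ∫⁻ x in φ ⁻¹' A, ENNReal.ofReal (√|(inducedMetric φ x).det|)

/-- The Riemannian volume of a subset `A` of `S³_r`, computed in the two central-projection charts
of the half-spheres `X⁴ > 0` and `X⁴ < 0`, which cover `S³_r` up to the equator `X⁴ = 0`, a great
2-sphere, of volume zero. -/
def sphereVolume (r : ℝ) (A : Set E4) : ℝ≥0∞ :=
  paramVolume (chartInv r) A + paramVolume (fun x => -chartInv r x) A

/-- The vertices of the Euclidean regular tetrahedron of edge length `a₀` centred at `0`, with one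
face parallel to the `xy`-plane. -/
def euclideanVertex (a₀ : ℝ) : Fin 4 → E3 :=
  ![!₂[a₀ / 2, -(√3 * a₀ / 6), -(√6 * a₀ / 12)],
    !₂[-(a₀ / 2), -(√3 * a₀ / 6), -(√6 * a₀ / 12)],
    !₂[0, √3 * a₀ / 3, -(√6 * a₀ / 12)],
    !₂[0, 0, √6 * a₀ / 4]]

/-- The solid Euclidean regular tetrahedron `T(a₀) ⊆ ℝ³` of edge length `a₀` centred at `0`. -/
def euclideanTetrahedron (a₀ : ℝ) : Set E3 := convexHull ℝ (Set.range (euclideanVertex a₀))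

/-- The edge length of the geodesic tetrahedron whose chart image is `T(a₀)`. -/
def geodesicEdge (r a₀ : ℝ) : ℝ :=
  2 * r * arctan (1 / 2 * (a₀ / √(r ^ 2 + a₀ ^ 2 / 8)))

/-- The maximal edge length `a_max = 2 arctan(√2) r`. -/
def maxEdge (r : ℝ) : ℝ := 2 * arctan (√2) * r

end

/-! Edge bound: in a regular tetrahedron `‖∑ v i‖² = 4r²(1 + 3 cos (a/r))`, and this is nonnegative,
so `cos (a/r) ≥ -1/3`, which is `a ≤ maxEdge r` (`edge_le`). In the equality case the vertices sum
to zero, so each face normal is orthogonal to all four of them. They span a hyperplane, hence the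
normals are positive multiples of one another and `T` is a closed half-sphere (`eq_halfSphere`).

Volume: the central projection has density `r⁴/(r² + ‖x‖²)²`, of total mass `π²r³`. A half-sphere
fills complementary half-spaces of the two charts, up to a null set (`sphereVolume_halfSphere`). The
tetrahedra `T(a₀)` increase to the whole chart, which gives the limit of the volumes.

The integral expression is evaluated separately: substitute `t = √2 sin θ`, write the arctangent as
an integral over a parameter, and exchange the integrations. -/

/-- The point `(x, s)` of `ℝ⁴ = ℝ³ × ℝ`. -/
def embed (x : E3) (s : ℝ) : E4 := !₂[x 0, x 1, x 2, s]

lemma inner_embed (x y : E3) (s t : ℝ) :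
    inner ℝ (embed x s) (embed y t) = inner ℝ x y + s * t := by
  simp [embed, PiLp.inner_apply, Fin.sum_univ_four, Fin.sum_univ_three]
  ring

lemma inner_embed_right (N : E4) (x : E3) (s : ℝ) :
    inner ℝ N (embed x s) = N 0 * x 0 + N 1 * x 1 + N 2 * x 2 + N 3 * s := by
  simp [embed, PiLp.inner_apply, Fin.sum_univ_four]
  ring

lemma norm_embed_sq (x : E3) (s : ℝ) : ‖embed x s‖ ^ 2 = ‖x‖ ^ 2 + s ^ 2 := by
  rw [← real_inner_self_eq_norm_sq, inner_embed, real_inner_self_eq_norm_sq]; ring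

lemma exists_eq_embed (X : E4) : ∃ x : E3, X = embed x (X 3) := by
  refine ⟨!₂[X 0, X 1, X 2], ?_⟩
  ext i
  fin_cases i <;> simp [embed]

lemma embed_smul (c : ℝ) (x : E3) (s : ℝ) : embed (c • x) (c * s) = c • embed x s := by
  ext i
  fin_cases i <;> simp [embed]

lemma chartInv_eq (r : ℝ) (x : E3) :
    chartInv r x = (r / √(r ^ 2 + ‖x‖ ^ 2)) • embed x r := rfl

/-! ### Central projection onto the open half-sphere -/

section chart
variable {r : ℝ} (hr : 0 < r)
include hr

lemma sqrt_pos_of_radius (x : E3) : 0 < √(r ^ 2 + ‖x‖ ^ 2) := by positivity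

lemma chart_factor_pos (x : E3) : 0 < r / √(r ^ 2 + ‖x‖ ^ 2) := by positivity

lemma norm_chartInv (x : E3) : ‖chartInv r x‖ = r := by
  have h : ‖embed x r‖ = √(r ^ 2 + ‖x‖ ^ 2) := by
    rw [← Real.sqrt_sq (norm_nonneg (embed x r)), norm_embed_sq, add_comm]
  rw [chartInv_eq, norm_smul, h, Real.norm_of_nonneg (chart_factor_pos hr x).le]
  field_simp

lemma chartInv_mem_sphere (x : E3) : chartInv r x ∈ sphere3 r := by
  simp [sphere3, norm_chartInv hr]

lemma inner_chartInv_nonneg_iff (N : E4) (x : E3) :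
    0 ≤ inner ℝ N (chartInv r x) ↔ 0 ≤ inner ℝ N (embed x r) := by
  rw [chartInv_eq, inner_smul_right, mul_nonneg_iff_of_pos_left (chart_factor_pos hr x)]

lemma chartInv_injective : Function.Injective (chartInv r) := by
  intro x y h
  have h3 := congrArg (fun X : E4 => X 3) h
  simp only [chartInv_eq, embed, PiLp.smul_apply, smul_eq_mul] at h3
  have hc : r / √(r ^ 2 + ‖x‖ ^ 2) = r / √(r ^ 2 + ‖y‖ ^ 2) := by
    simpa [hr.ne'] using h3
  rw [chartInv_eq, chartInv_eq, hc] at h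
  have h' := smul_right_injective E4 (chart_factor_pos hr y).ne' h
  ext i
  fin_cases i
  · simpa [embed] using congrArg (fun X : E4 => X 0) h'
  · simpa [embed] using congrArg (fun X : E4 => X 1) h'
  · simpa [embed] using congrArg (fun X : E4 => X 2) h'

lemma exists_eq_chartInv {X : E4} (hX : X ∈ sphere3 r) (h3 : 0 < X 3) :
    ∃ x : E3, X = chartInv r x := by
  obtain ⟨x, hx⟩ := exists_eq_embed X
  have hn : ‖X‖ = r := by simpa [sphere3] using hX
  have hsq : ‖x‖ ^ 2 + X 3 ^ 2 = r ^ 2 := by rw [← norm_embed_sq, ← hx, hn]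
  refine ⟨(r / X 3) • x, ?_⟩
  have e : embed ((r / X 3) • x) r = (r / X 3) • X := by
    have := embed_smul (r / X 3) x (X 3)
    rwa [div_mul_cancel₀ _ h3.ne', ← hx] at this
  have hs : √(r ^ 2 + ‖(r / X 3) • x‖ ^ 2) = r ^ 2 / X 3 := by
    rw [Real.sqrt_eq_iff_mul_self_eq_of_pos (by positivity), norm_smul, mul_pow,
      Real.norm_of_nonneg (by positivity)]
    field_simp
    linear_combination (-1 : ℝ) * hsq
  rw [chartInv_eq, e, hs, smul_smul]
  rw [show r / (r ^ 2 / X 3) * (r / X 3) = 1 by field_simp, one_smul]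

end chart

/-- Half-angle formula: it converts inner products of vertices into edge lengths with `t = tan (a /
(2r))`. -/
lemma arccos_eq_two_mul_arctan {t : ℝ} (ht : 0 ≤ t) :
    arccos ((1 - t ^ 2) / (1 + t ^ 2)) = 2 * arctan t := by
  have h : cos (2 * arctan t) = (1 - t ^ 2) / (1 + t ^ 2) := by
    rw [cos_two_mul, cos_sq_arctan]
    field_simp
    ring
  rw [← h, arccos_cos]
  · have := Real.arctan_nonneg.2 ht
    linarith
  · linarith [arctan_lt_pi_div_two t]

lemma cos_two_mul_arctan_sqrt_two : cos (2 * arctan √2) = -1 / 3 := by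
  rw [cos_two_mul, cos_sq_arctan, Real.sq_sqrt (by norm_num)]
  norm_num

/-! ### The Euclidean regular tetrahedron -/

section tetrahedron
variable {a : ℝ}

lemma inner_euclideanVertex_self (a : ℝ) (i : Fin 4) :
    inner ℝ (euclideanVertex a i) (euclideanVertex a i) = 3 * a ^ 2 / 8 := by
  have h3 : √3 ^ 2 = 3 := Real.sq_sqrt (by norm_num)
  have h6 : √6 ^ 2 = 6 := Real.sq_sqrt (by norm_num)
  fin_cases i <;>
    simp [-inner_self_eq_norm_sq_to_K, euclideanVertex,
      PiLp.inner_apply, Fin.sum_univ_three] <;>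
    ring_nf <;> simp only [h3, h6] <;> ring

lemma inner_euclideanVertex_of_ne (a : ℝ) {i j : Fin 4} (hij : i ≠ j) :
    inner ℝ (euclideanVertex a i) (euclideanVertex a j) = -(a ^ 2 / 8) := by
  have h3 : √3 ^ 2 = 3 := Real.sq_sqrt (by norm_num)
  have h6 : √6 ^ 2 = 6 := Real.sq_sqrt (by norm_num)
  fin_cases i <;> fin_cases j <;> first | exact absurd rfl hij | skip
  all_goals
    simp [euclideanVertex, PiLp.inner_apply, Fin.sum_univ_three]
    ring_nf
    simp only [h3, h6]
    ring

lemma sum_euclideanVertex (a : ℝ) : ∑ i, euclideanVertex a i = 0 := by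
  ext k
  fin_cases k <;> simp [euclideanVertex, Fin.sum_univ_four] <;> ring

/-- The vertices form a tight frame; taking traces gives the constant, `4 · (3a²/8) = 3 · (a²/2)`.
-/
lemma sum_inner_smul_euclideanVertex (a : ℝ) (x : E3) :
    ∑ i, inner ℝ (euclideanVertex a i) x • euclideanVertex a i = (a ^ 2 / 2) • x := by
  have h3 : √3 ^ 2 = 3 := Real.sq_sqrt (by norm_num)
  have h6 : √6 ^ 2 = 6 := Real.sq_sqrt (by norm_num)
  ext k
  fin_cases k <;>
    simp [euclideanVertex, Fin.sum_univ_four, PiLp.inner_apply, Fin.sum_univ_three] <;>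
    ring_nf <;> simp only [h3, h6] <;> ring

/-- Each vertex is an inner normal of the opposite face. Conversely, by the frame identity,
`(2/a²)(⟪vᵢ, x⟫ + a²/8)` are barycentric coordinates of `x`. -/
lemma mem_euclideanTetrahedron_iff (ha : 0 < a) (x : E3) :
    x ∈ euclideanTetrahedron a ↔ ∀ i, 0 ≤ inner ℝ (euclideanVertex a i) x + a ^ 2 / 8 := by
  constructor
  · intro hx i
    have hc : Convex ℝ {x : E3 | -(a ^ 2 / 8) ≤ inner ℝ (euclideanVertex a i) x} :=
      convex_halfSpace_ge (innerₗ E3 (euclideanVertex a i)).isLinear _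
    have := convexHull_min (s := Set.range (euclideanVertex a)) ?_ hc hx
    · have h : -(a ^ 2 / 8) ≤ inner ℝ (euclideanVertex a i) x := this
      linarith
    · rintro _ ⟨j, rfl⟩
      rw [Set.mem_ofPred_eq]
      rcases eq_or_ne i j with rfl | hij
      · rw [inner_euclideanVertex_self]; nlinarith
      · rw [inner_euclideanVertex_of_ne a hij]
  · intro h
    have hs : ∑ i, inner ℝ (euclideanVertex a i) x = 0 := by
      rw [← sum_inner, sum_euclideanVertex, inner_zero_left]
    have hx : x = ∑ i, ((2 / a ^ 2) * (inner ℝ (euclideanVertex a i) x + a ^ 2 / 8)) •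
        euclideanVertex a i := by
      simp only [mul_smul, add_smul, Finset.sum_add_distrib, ← Finset.smul_sum]
      rw [sum_inner_smul_euclideanVertex, sum_euclideanVertex, smul_zero, add_zero, smul_smul,
        show 2 / a ^ 2 * (a ^ 2 / 2) = 1 by field_simp, one_smul]
    rw [hx]
    refine (convex_convexHull ℝ _).sum_mem (fun i _ => ?_) ?_ fun i _ =>
      subset_convexHull ℝ _ ⟨i, rfl⟩
    · have := h i
      positivity
    · rw [← Finset.mul_sum, Finset.sum_add_distrib, hs]
      simp
      field_simp
      norm_num

end tetrahedron

/-! ### Edge lengths and the extremal tetrahedron -/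

section main
variable {r : ℝ} (hr : 0 < r)
include hr

lemma geodesicDist_eq_of_inner {X Y : E4} (hX : ‖X‖ = r) (hY : ‖Y‖ = r) {t : ℝ} (ht : 0 ≤ t)
    (h : inner ℝ X Y = r ^ 2 * ((1 - t ^ 2) / (1 + t ^ 2))) :
    geodesicDist r X Y = 2 * r * arctan t := by
  rw [geodesicDist, InnerProductGeometry.angle, hX, hY, h, ← pow_two,
    mul_div_cancel_left₀ _ (by positivity), arccos_eq_two_mul_arctan ht]
  ring

lemma isRegularGeodesicTetrahedron_chartInv {a : ℝ} (ha : 0 < a) :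
    IsRegularGeodesicTetrahedron r (geodesicEdge r a)
      (fun i => chartInv r (euclideanVertex a i)) (chartInv r '' euclideanTetrahedron a) where
  edge_pos := by
    have : 0 < arctan (1 / 2 * (a / √(r ^ 2 + a ^ 2 / 8))) := Real.arctan_pos.2 (by positivity)
    unfold geodesicEdge
    positivity
  vertex_mem i := Set.mem_image_of_mem _ (subset_convexHull ℝ _ ⟨i, rfl⟩)
  edge_eq i j hij := by
    refine geodesicDist_eq_of_inner hr (norm_chartInv hr _) (norm_chartInv hr _) (by positivity) ?_
    have hn : ∀ i, ‖euclideanVertex a i‖ ^ 2 = 3 * a ^ 2 / 8 := fun i => by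
      rw [← real_inner_self_eq_norm_sq, inner_euclideanVertex_self]
    have h' : √(r ^ 2 + a ^ 2 / 8) ^ 2 = r ^ 2 + a ^ 2 / 8 := Real.sq_sqrt (by positivity)
    rw [chartInv_eq, chartInv_eq, inner_smul_left, inner_smul_right, inner_embed, hn, hn,
      inner_euclideanVertex_of_ne a hij, mul_pow, div_pow a, h']
    have h : √(r ^ 2 + 3 * a ^ 2 / 8) ^ 2 = r ^ 2 + 3 * a ^ 2 / 8 := Real.sq_sqrt (by positivity)
    simp only [conj_trivial]
    rw [← mul_assoc, ← pow_two, div_pow, h]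
    field_simp
    ring
  faces := by
    -- The normals homogenize the affine face inequalities of `T(a)` at height `r`.
    have hN : ∀ i (x : E3), inner ℝ (embed (euclideanVertex a i) (a ^ 2 / (8 * r))) (embed x r) =
        inner ℝ (euclideanVertex a i) x + a ^ 2 / 8 := fun i x => by
      rw [inner_embed]; field_simp
    refine ⟨fun i => embed (euclideanVertex a i) (a ^ 2 / (8 * r)), fun i j hij => ?_,
      ⟨chartInv r 0, chartInv_mem_sphere hr 0, fun i => ?_⟩, ?_⟩
    · rw [chartInv_eq, inner_smul_right, hN, inner_euclideanVertex_of_ne a hij]; simp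
    · rw [chartInv_eq, inner_smul_right, hN, inner_zero_right, zero_add]
      have := chart_factor_pos hr (0 : E3)
      positivity
    · ext X
      simp only [Set.mem_image, Set.mem_ofPred_eq]
      constructor
      · rintro ⟨x, hx, rfl⟩
        refine ⟨chartInv_mem_sphere hr x, fun i => ?_⟩
        rw [inner_chartInv_nonneg_iff hr, hN]
        exact (mem_euclideanTetrahedron_iff ha x).1 hx i
      · rintro ⟨hX, h⟩
        -- Summing the four inequalities gives `X 3 ≥ 0`. If `X 3 = 0`, nonnegative terms with sum
        -- zero all vanish, and the frame identity forces `X = 0`.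
        have hpos : 0 < X 3 := by
          obtain ⟨x, hx⟩ := exists_eq_embed X
          have hi : ∀ i, inner ℝ (embed (euclideanVertex a i) (a ^ 2 / (8 * r))) X =
              inner ℝ (euclideanVertex a i) x + a ^ 2 / (8 * r) * X 3 := fun i => by
            conv_lhs => rw [hx]
            rw [inner_embed]
          have hs : ∑ i, inner ℝ (euclideanVertex a i) x = 0 := by
            rw [← sum_inner, sum_euclideanVertex, inner_zero_left]
          have hsum : ∑ i, (inner ℝ (euclideanVertex a i) x + a ^ 2 / (8 * r) * X 3) =
              a ^ 2 / (2 * r) * X 3 := by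
            rw [Finset.sum_add_distrib, hs]; simp; field_simp; ring
          simp only [hi] at h
          have h0 : 0 ≤ a ^ 2 / (2 * r) * X 3 := hsum ▸ Finset.sum_nonneg fun i _ => h i
          refine lt_of_le_of_ne (nonneg_of_mul_nonneg_right h0 (by positivity)) fun h3 => ?_
          have hz : ∀ i, inner ℝ (euclideanVertex a i) x = 0 := by
            rw [← h3] at h
            simp only [mul_zero, add_zero] at h
            intro i
            exact (Finset.sum_eq_zero_iff_of_nonneg fun i _ => h i).1 hs i (Finset.mem_univ i)
          have hx0 : (a ^ 2 / 2) • x = 0 := by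
            rw [← sum_inner_smul_euclideanVertex]; simp [hz]
          have hx0 : x = 0 := (smul_eq_zero.1 hx0).resolve_left (by positivity)
          have hn : ‖X‖ = r := by simpa [sphere3] using hX
          have := norm_embed_sq x (X 3)
          rw [← hx, hn, hx0, ← h3] at this
          simp [hr.ne'] at this
        obtain ⟨x, rfl⟩ := exists_eq_chartInv hr hX hpos
        refine ⟨x, (mem_euclideanTetrahedron_iff ha x).2 fun i => ?_, rfl⟩
        rw [← hN, ← inner_chartInv_nonneg_iff hr]
        exact h i

lemma maxEdge_pos : 0 < maxEdge r := by
  have : 0 < arctan √2 := Real.arctan_pos.2 (by positivity)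
  unfold maxEdge
  positivity

lemma exists_isRegularGeodesicTetrahedron_maxEdge :
    ∃ (v : Fin 4 → E4) (T : Set E4), IsRegularGeodesicTetrahedron r (maxEdge r) v T := by
  -- The circumradius `a √(3/8)` of `T(a)` then equals `r`, so the vertices lie on the equator and
  -- all four normals can be the north pole.
  set a := r * √(8 / 3) with ha
  have ha2 : a ^ 2 = r ^ 2 * (8 / 3) := by rw [ha, mul_pow, Real.sq_sqrt (by norm_num)]
  have hn : ∀ i, ‖embed (euclideanVertex a i) 0‖ = r := fun i => by
    rw [← Real.sqrt_sq (norm_nonneg (embed _ _)), ← real_inner_self_eq_norm_sq, inner_embed,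
      inner_euclideanVertex_self, ha2, ← Real.sqrt_sq hr.le]
    congr 1
    rw [Real.sqrt_sq hr.le]
    ring
  have hv : ∀ x : E3, inner ℝ (embed 0 1) (embed x 0) = (0 : ℝ) := fun x => by
    simp [inner_embed]
  refine ⟨fun i => embed (euclideanVertex a i) 0,
    {x | x ∈ sphere3 r ∧ ∀ _ : Fin 4, 0 ≤ inner ℝ (embed 0 1) x}, maxEdge_pos hr,
    fun i => ⟨by simp [sphere3, hn], fun _ => (hv _).ge⟩, fun i j hij => ?_, fun _ => embed 0 1,
    fun i j _ => hv _, ⟨embed 0 r, ?_, fun i => by simp [inner_embed, hr]⟩, rfl⟩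
  · rw [geodesicDist_eq_of_inner hr (hn i) (hn j) (Real.sqrt_nonneg 2), maxEdge]
    · ring
    · rw [inner_embed, inner_euclideanVertex_of_ne a hij, ha2, Real.sq_sqrt (by norm_num)]
      ring
  · have := norm_embed_sq 0 r
    simp only [norm_zero] at this
    have h : ‖embed 0 r‖ = r := by
      rw [← Real.sqrt_sq (norm_nonneg (embed _ _)), this]; simp [Real.sqrt_sq hr.le]
    simp [sphere3, h]

omit hr in
lemma IsRegularGeodesicTetrahedron.norm_vertex {a : ℝ} {v : Fin 4 → E4} {T : Set E4}
    (h : IsRegularGeodesicTetrahedron r a v T) (i : Fin 4) : ‖v i‖ = r := by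
  obtain ⟨n, -, -, hT⟩ := h.faces
  have := h.vertex_mem i
  rw [hT] at this
  simpa [sphere3] using this.1

lemma IsRegularGeodesicTetrahedron.inner_vertex {a : ℝ} {v : Fin 4 → E4} {T : Set E4}
    (h : IsRegularGeodesicTetrahedron r a v T) {i j : Fin 4} (hij : i ≠ j) :
    inner ℝ (v i) (v j) = r ^ 2 * cos (a / r) := by
  rw [← h.edge_eq i j hij, geodesicDist, mul_div_cancel_left₀ _ hr.ne',
    ← InnerProductGeometry.cos_angle_mul_norm_mul_norm, h.norm_vertex, h.norm_vertex]
  ring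

lemma IsRegularGeodesicTetrahedron.norm_sum_sq {a : ℝ} {v : Fin 4 → E4} {T : Set E4}
    (h : IsRegularGeodesicTetrahedron r a v T) :
    ‖∑ i, v i‖ ^ 2 = 4 * r ^ 2 * (1 + 3 * cos (a / r)) := by
  have e : ∀ i j, inner ℝ (v i) (v j) =
      if i = j then r ^ 2 else r ^ 2 * cos (a / r) := by
    intro i j
    split_ifs with hij
    · rw [hij, real_inner_self_eq_norm_sq, h.norm_vertex]
    · exact h.inner_vertex hr hij
  rw [← real_inner_self_eq_norm_sq]
  rw [sum_inner]
  simp only [inner_sum, e]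
  simp [Fin.sum_univ_four]
  ring

lemma IsRegularGeodesicTetrahedron.edge_le {a : ℝ} {v : Fin 4 → E4} {T : Set E4}
    (h : IsRegularGeodesicTetrahedron r a v T) : a ≤ maxEdge r := by
  by_contra! hlt
  -- Angles stay in `[0, π]`, where cosine is strictly decreasing.
  have hπ : a / r ≤ π := by
    rw [← h.edge_eq 0 1 (by decide), geodesicDist, mul_div_cancel_left₀ _ hr.ne']
    exact InnerProductGeometry.angle_le_pi _ _
  have hlt' : 2 * arctan √2 < a / r := by rwa [lt_div_iff₀ hr]
  have h0 : 0 ≤ 2 * arctan √2 := by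
    have := Real.arctan_nonneg.2 (Real.sqrt_nonneg 2)
    linarith
  have hcos := cos_lt_cos_of_nonneg_of_le_pi h0 hπ hlt'
  rw [cos_two_mul_arctan_sqrt_two] at hcos
  have := h.norm_sum_sq hr
  have hp : 0 ≤ ‖∑ i, v i‖ ^ 2 := by positivity
  rw [this] at hp
  have := nonneg_of_mul_nonneg_right hp (by positivity)
  linarith

lemma isGreatest_maxEdge :
    IsGreatest {a : ℝ | ∃ (v : Fin 4 → E4) (T : Set E4), IsRegularGeodesicTetrahedron r a v T}
      (maxEdge r) :=
  ⟨exists_isRegularGeodesicTetrahedron_maxEdge hr, fun _ ⟨_, _, h⟩ => h.edge_le hr⟩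

/-- A regular geodesic tetrahedron of maximal edge length is a closed half-sphere. -/
lemma IsRegularGeodesicTetrahedron.eq_halfSphere {v : Fin 4 → E4} {T : Set E4}
    (h : IsRegularGeodesicTetrahedron r (maxEdge r) v T) :
    ∃ N : E4, N ≠ 0 ∧ T = {x | x ∈ sphere3 r ∧ 0 ≤ inner ℝ N x} := by
  have hc : cos (maxEdge r / r) = -1 / 3 := by
    rw [maxEdge, mul_div_cancel_right₀ _ hr.ne', cos_two_mul_arctan_sqrt_two]
  have hsum : ∑ i, v i = 0 := by
    have := h.norm_sum_sq hr
    rw [hc] at this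
    norm_num at this
    exact this
  have hin : ∀ i j, i ≠ j → inner ℝ (v i) (v j) = r ^ 2 * (-1 / 3) := fun i j hij => by
    rw [h.inner_vertex hr hij, hc]
  have hself : ∀ i, inner ℝ (v i) (v i) = r ^ 2 := fun i => by
    rw [real_inner_self_eq_norm_sq, h.norm_vertex]
  obtain ⟨n, hn, ⟨x, -, hx⟩, hT⟩ := h.faces
  have horth : ∀ i j, inner ℝ (n i) (v j) = 0 := by
    intro i j
    rcases ne_or_eq i j with hij | rfl
    · exact hn i j hij
    · have h0 : inner ℝ (n i) (∑ j, v j) = 0 := by rw [hsum, inner_zero_right]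
      rwa [inner_sum, Finset.sum_eq_single i (fun j _ hj => hn i j hj.symm) (by simp)] at h0
  -- Three vertices suffice: the fourth is minus their sum.
  let w : Fin 3 → E4 := fun k => v k.castSucc
  have hli : LinearIndependent ℝ w := by
    rw [Fintype.linearIndependent_iff]
    intro g hg
    have e : ∀ k, inner ℝ (v k) (∑ i, g i • w i) = 0 := fun k => by rw [hg, inner_zero_right]
    have e0 := e 0
    have e1 := e 1
    have e2 := e 2
    simp only [Fin.sum_univ_three, inner_add_right, inner_smul_right, w] at e0 e1 e2
    change g 0 * inner ℝ (v 0) (v 0) + g 1 * inner ℝ (v 0) (v 1) +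
      g 2 * inner ℝ (v 0) (v 2) = 0 at e0
    change g 0 * inner ℝ (v 1) (v 0) + g 1 * inner ℝ (v 1) (v 1) +
      g 2 * inner ℝ (v 1) (v 2) = 0 at e1
    change g 0 * inner ℝ (v 2) (v 0) + g 1 * inner ℝ (v 2) (v 1) +
      g 2 * inner ℝ (v 2) (v 2) = 0 at e2
    rw [hself, hin 0 1 (by decide), hin 0 2 (by decide)] at e0
    rw [hself, hin 1 0 (by decide), hin 1 2 (by decide)] at e1
    rw [hself, hin 2 0 (by decide), hin 2 1 (by decide)] at e2
    have hr2 : r ^ 2 ≠ 0 := by positivity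
    -- The coefficients are the rows of the inverse of the Gram matrix with diagonal `1` and
    -- off-diagonal `-1/3`.
    have f0 : g 0 = 0 := mul_left_cancel₀ hr2 (by
      linear_combination 3 / 2 * e0 + 3 / 4 * e1 + 3 / 4 * e2)
    have f1 : g 1 = 0 := mul_left_cancel₀ hr2 (by
      linear_combination 3 / 2 * e1 + 3 / 4 * e0 + 3 / 4 * e2)
    have f2 : g 2 = 0 := mul_left_cancel₀ hr2 (by
      linear_combination 3 / 2 * e2 + 3 / 4 * e1 + 3 / 4 * e0)
    intro i
    fin_cases i <;> assumption
  have hfin : Module.finrank ℝ (Submodule.span ℝ (Set.range w))ᗮ = 1 := by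
    have h1 := finrank_span_eq_card hli
    have h2 := (Submodule.span ℝ (Set.range w)).finrank_add_finrank_orthogonal
    rw [h1] at h2
    simp at h2
    omega
  have hmem : ∀ i, n i ∈ (Submodule.span ℝ (Set.range w))ᗮ := by
    intro i
    rw [Submodule.mem_orthogonal']
    intro u hu
    induction hu using Submodule.span_induction with
    | mem u hu => obtain ⟨k, rfl⟩ := hu; exact horth i _
    | zero => simp
    | add u u' _ _ hu hu' => rw [inner_add_right, hu, hu', add_zero]
    | smul c u _ hu => rw [inner_smul_right, hu, mul_zero]
  have hN : n 0 ≠ 0 := fun h0 => by simpa [h0] using hx 0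
  -- All normals lie on one line; the common interior point makes the proportionality factors
  -- positive.
  have hc : ∀ i, ∃ c : ℝ, 0 < c ∧ n i = c • n 0 := by
    intro i
    obtain ⟨c, hc⟩ := (finrank_eq_one_iff_of_nonzero'
      (⟨n 0, hmem 0⟩ : (Submodule.span ℝ (Set.range w))ᗮ) (by simpa using hN)).1 hfin ⟨n i, hmem i⟩
    have hc' : c • n 0 = n i := congrArg Subtype.val hc
    refine ⟨c, ?_, hc'.symm⟩
    have := hx i
    rw [← hc', inner_smul_left] at this
    exact pos_of_mul_pos_left this (hx 0).le
  refine ⟨n 0, hN, ?_⟩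
  rw [hT]
  ext y
  refine and_congr_right fun _ => ⟨fun hy => hy 0, fun hy i => ?_⟩
  obtain ⟨c, hc, hci⟩ := hc i
  rw [hci, inner_smul_left]
  exact mul_nonneg hc.le hy

lemma tendsto_geodesicEdge : Tendsto (geodesicEdge r) atTop (𝓝 (maxEdge r)) := by
  have h1 : Tendsto (fun a : ℝ => r ^ 2 / a ^ 2 + 1 / 8) atTop (𝓝 (0 + 1 / 8)) :=
    (tendsto_const_nhds.div_atTop (tendsto_pow_atTop (by norm_num))).add_const _
  have h2 : Tendsto (fun a : ℝ => 2 * r * arctan (1 / 2 * (1 / √(r ^ 2 / a ^ 2 + 1 / 8)))) atTop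
      (𝓝 (2 * r * arctan (1 / 2 * (1 / √(0 + 1 / 8))))) := by
    refine ((continuous_arctan.tendsto _).comp ((Tendsto.div tendsto_const_nhds
      ((Real.continuous_sqrt.tendsto _).comp h1) ?_).const_mul _)).const_mul _
    positivity
  have e : 1 / 2 * (1 / √(0 + 1 / 8)) = √2 := by
    have : √(0 + 1 / 8 : ℝ) = 1 / (2 * √2) := by
      rw [Real.sqrt_eq_iff_mul_self_eq_of_pos (by positivity)]
      field_simp
      rw [Real.sq_sqrt (by norm_num)]
      norm_num
    rw [this]
    field_simp
  rw [e, show 2 * r * arctan √2 = maxEdge r by unfold maxEdge; ring] at h2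
  refine h2.congr' ?_
  filter_upwards [eventually_gt_atTop 0] with a ha
  rw [geodesicEdge]
  have : r ^ 2 + a ^ 2 / 8 = a ^ 2 * (r ^ 2 / a ^ 2 + 1 / 8) := by field_simp
  rw [this, Real.sqrt_mul (by positivity), Real.sqrt_sq ha.le]
  congr 3
  field_simp

end main

/-! ### Evaluation of the volume integral -/

lemma mul_cos_sq_add_mul_sin_sq_pos {p q : ℝ} (hp : 0 < p) (hq : 0 < q) (θ : ℝ) :
    0 < p * cos θ ^ 2 + q * sin θ ^ 2 := by
  by_cases hc : cos θ = 0
  · have hsc := sin_sq_add_cos_sq θ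
    have : sin θ ^ 2 = 1 := by rw [hc] at hsc; linarith
    rw [hc, this]; linarith
  · positivity

/-- For `p, q > 0` the function `θ + arctan ((q - p) sin θ cos θ / (p cos² θ + q sin² θ))`
is a smooth antiderivative of `p q / (p² cos² θ + q² sin² θ)`. -/
lemma hasDerivAt_add_arctan {p q : ℝ} (hp : 0 < p) (hq : 0 < q) (θ : ℝ) :
    HasDerivAt (fun θ => θ + arctan ((q - p) * (sin θ * cos θ) / (p * cos θ ^ 2 + q * sin θ ^ 2)))
      (p * q / (p ^ 2 * cos θ ^ 2 + q ^ 2 * sin θ ^ 2)) θ := by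
  have hsc := sin_sq_add_cos_sq θ
  have hD := mul_cos_sq_add_mul_sin_sq_pos hp hq θ
  have hE := mul_cos_sq_add_mul_sin_sq_pos (pow_pos hp 2) (pow_pos hq 2) θ
  have h1 : HasDerivAt (fun θ => (q - p) * (sin θ * cos θ))
      ((q - p) * (cos θ * cos θ + sin θ * -sin θ)) θ :=
    ((hasDerivAt_sin θ).mul (hasDerivAt_cos θ)).const_mul _
  have h2 : HasDerivAt (fun θ => p * cos θ ^ 2 + q * sin θ ^ 2)
      (p * (2 * cos θ * -sin θ) + q * (2 * sin θ * cos θ)) θ := by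
    have := (((hasDerivAt_cos θ).pow 2).const_mul p).add (((hasDerivAt_sin θ).pow 2).const_mul q)
    simpa [Pi.add_def] using this
  have h3 := (hasDerivAt_id θ).add (h1.div h2 hD.ne').arctan
  refine h3.congr_deriv ?_
  -- Both sides are the squared modulus of `(p cos θ + i q sin θ) e^{-iθ}`; the antiderivative is
  -- the continuous argument of `p cos θ + i q sin θ`.
  have hF : (p * cos θ ^ 2 + q * sin θ ^ 2) ^ 2 + ((q - p) * (sin θ * cos θ)) ^ 2 =
      p ^ 2 * cos θ ^ 2 + q ^ 2 * sin θ ^ 2 := by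
    have : cos θ ^ 2 = 1 - sin θ ^ 2 := by linarith
    rw [mul_pow (q - p), mul_pow (sin θ), this]
    ring
  have hG : 1 + ((q - p) * (sin θ * cos θ) / (p * cos θ ^ 2 + q * sin θ ^ 2)) ^ 2 =
      (p ^ 2 * cos θ ^ 2 + q ^ 2 * sin θ ^ 2) / (p * cos θ ^ 2 + q * sin θ ^ 2) ^ 2 := by
    rw [← hF]; field_simp
  simp only [Pi.div_apply]
  rw [hG]
  field_simp
  have : cos θ ^ 2 = 1 - sin θ ^ 2 := by linarith
  ring_nf
  simp only [show cos θ ^ 4 = (cos θ ^ 2) ^ 2 by ring, this]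
  ring

lemma integral_inv_cos_sq_add_sin_sq {p q : ℝ} (hp : 0 < p) (hq : 0 < q) :
    ∫ θ in (0 : ℝ)..π / 2, 1 / (p ^ 2 * cos θ ^ 2 + q ^ 2 * sin θ ^ 2) = π / (2 * (p * q)) := by
  have hE : ∀ θ, p ^ 2 * cos θ ^ 2 + q ^ 2 * sin θ ^ 2 ≠ 0 := fun θ =>
    (mul_cos_sq_add_mul_sin_sq_pos (pow_pos hp 2) (pow_pos hq 2) θ).ne'
  have h := intervalIntegral.integral_eq_sub_of_hasDerivAt (a := 0) (b := π / 2)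
    (fun θ _ => hasDerivAt_add_arctan hp hq θ)
    ((Continuous.div (by fun_prop) (by fun_prop) hE).intervalIntegrable _ _)
  simp only [sin_pi_div_two, cos_pi_div_two, sin_zero, cos_zero] at h
  simp only [div_eq_mul_one_div (p * q), intervalIntegral.integral_const_mul] at h
  simp at h
  simp only [one_div]
  field_simp at h ⊢
  linarith

lemma arctan_eq_intervalIntegral (y : ℝ) : arctan y = ∫ l in (0 : ℝ)..1, y / (1 + (l * y) ^ 2) := by
  have h : ∀ l ∈ Set.uIcc (0 : ℝ) 1,
      HasDerivAt (fun l => arctan (l * y)) (y / (1 + (l * y) ^ 2)) l := fun l _ => by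
    have := ((hasDerivAt_id l).mul_const y).arctan
    simp only [id, one_mul] at this
    exact this.congr_deriv (by ring)
  rw [intervalIntegral.integral_eq_sub_of_hasDerivAt h
    ((Continuous.div (by fun_prop) (by fun_prop) fun l => by positivity).intervalIntegrable _ _)]
  simp

/-- The inner integral after expanding the arctangent. -/
lemma integral_sin_sq_div (l : ℝ) :
    ∫ θ in (0 : ℝ)..π / 2, 2 * sin θ ^ 2 / ((3 - 2 * sin θ ^ 2) * (1 + l ^ 2 * (2 * sin θ ^ 2))) =
      π / 2 * (√3 / (1 + 3 * l ^ 2) - 1 / ((1 + 3 * l ^ 2) * √(1 + 2 * l ^ 2))) := by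
  have h3 : √3 ^ 2 = 3 := Real.sq_sqrt (by norm_num)
  have hl : √(1 + 2 * l ^ 2) ^ 2 = 1 + 2 * l ^ 2 := Real.sq_sqrt (by positivity)
  have hl0 : 0 < √(1 + 2 * l ^ 2) := by positivity
  -- Partial fractions in `sin² θ`, each term brought to the form `1 / (p² cos² θ + q² sin² θ)`.
  have e : ∀ θ, 2 * sin θ ^ 2 / ((3 - 2 * sin θ ^ 2) * (1 + l ^ 2 * (2 * sin θ ^ 2))) =
      3 / (1 + 3 * l ^ 2) * (1 / (√3 ^ 2 * cos θ ^ 2 + 1 ^ 2 * sin θ ^ 2)) -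
        1 / (1 + 3 * l ^ 2) * (1 / (1 ^ 2 * cos θ ^ 2 + √(1 + 2 * l ^ 2) ^ 2 * sin θ ^ 2)) := by
    intro θ
    have hs : sin θ ^ 2 ≤ 1 := sin_sq_le_one θ
    rw [h3, hl, cos_sq']
    have e1 : 3 * (1 - sin θ ^ 2) + 1 ^ 2 * sin θ ^ 2 = 3 - 2 * sin θ ^ 2 := by ring
    have e2 : 1 ^ 2 * (1 - sin θ ^ 2) + (1 + 2 * l ^ 2) * sin θ ^ 2 =
      1 + l ^ 2 * (2 * sin θ ^ 2) := by ring
    rw [e1, e2]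
    have h1 : 3 - 2 * sin θ ^ 2 ≠ 0 := by linarith
    have h2 : 1 + l ^ 2 * (2 * sin θ ^ 2) ≠ 0 := by positivity
    have h4 : 1 + 3 * l ^ 2 ≠ 0 := by positivity
    field_simp
    ring
  have hi : ∀ {p q : ℝ}, 0 < p → 0 < q → ∀ c : ℝ, IntervalIntegrable
      (fun θ => c * (1 / (p ^ 2 * cos θ ^ 2 + q ^ 2 * sin θ ^ 2))) volume 0 (π / 2) :=
    fun hp hq c => (continuous_const.mul (Continuous.div (by fun_prop) (by fun_prop) fun θ =>
      (mul_cos_sq_add_mul_sin_sq_pos (pow_pos hp 2) (pow_pos hq 2) θ).ne')).intervalIntegrable _ _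
  simp only [e]
  rw [intervalIntegral.integral_sub (hi (by positivity) one_pos _) (hi one_pos hl0 _),
    intervalIntegral.integral_const_mul, intervalIntegral.integral_const_mul,
    integral_inv_cos_sq_add_sin_sq (by positivity) one_pos,
    integral_inv_cos_sq_add_sin_sq one_pos hl0]
  have : 0 < √3 := by positivity
  have h4 : 1 + 3 * l ^ 2 ≠ 0 := by positivity
  field_simp
  linear_combination (-√(1 + l ^ 2 * 2)) * h3

lemma integral_sqrt_three_div :
    ∫ l in (0 : ℝ)..1, (√3 / (1 + 3 * l ^ 2) - 1 / ((1 + 3 * l ^ 2) * √(1 + 2 * l ^ 2))) =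
      π / 6 := by
  have h3 : √3 ^ 2 = 3 := Real.sq_sqrt (by norm_num)
  have hd : ∀ l ∈ Set.uIcc (0 : ℝ) 1, HasDerivAt
      (fun l => arctan (l * √3) - arctan (l / √(1 + 2 * l ^ 2)))
      (√3 / (1 + 3 * l ^ 2) - 1 / ((1 + 3 * l ^ 2) * √(1 + 2 * l ^ 2))) l := by
    intro l _
    have hl : √(1 + 2 * l ^ 2) ^ 2 = 1 + 2 * l ^ 2 := Real.sq_sqrt (by positivity)
    have hl0 : 0 < √(1 + 2 * l ^ 2) := by positivity
    have h1 := ((hasDerivAt_id l).mul_const √3).arctan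
    have h2 : HasDerivAt (fun l : ℝ => 1 + 2 * l ^ 2) (2 * (2 * l)) l := by
      simpa using (((hasDerivAt_id l).pow 2).const_mul 2).const_add 1
    have h4 := ((hasDerivAt_id l).div (h2.sqrt (by positivity)) hl0.ne').arctan
    refine (h1.sub h4).congr_deriv ?_
    simp only [id]
    congr 1
    · rw [mul_pow, h3]; ring
    · simp only [Pi.div_apply, id]
      rw [div_pow, hl]
      have h4 : 1 + 3 * l ^ 2 ≠ 0 := by positivity
      have h5 : 1 + 2 * l ^ 2 ≠ 0 := by positivity
      have h6 : 1 + l ^ 2 / (1 + 2 * l ^ 2) = (1 + 3 * l ^ 2) / (1 + 2 * l ^ 2) := by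
        field_simp; ring
      rw [h6]
      field_simp
      rw [mul_comm (l ^ 2) 2, hl]
      ring
  have hc : Continuous fun l : ℝ =>
      √3 / (1 + 3 * l ^ 2) - 1 / ((1 + 3 * l ^ 2) * √(1 + 2 * l ^ 2)) :=
    (Continuous.div (by fun_prop) (by fun_prop) fun l => by positivity).sub
      (Continuous.div (by fun_prop) (by fun_prop) fun l => by positivity)
  rw [intervalIntegral.integral_eq_sub_of_hasDerivAt hd (hc.intervalIntegrable _ _)]
  norm_num
  ring

/-- Expanding the arctangent over `l ∈ [0, 1]` makes the integrand rational in `sin θ`; Fubini then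
gives `(π/2) · (π/6)`. -/
lemma integral_sin_mul_arctan :
    ∫ θ in (0 : ℝ)..π / 2, √2 * sin θ * arctan (√2 * sin θ) / (3 - 2 * sin θ ^ 2) =
      π ^ 2 / 12 := by
  have h2 : √2 ^ 2 = 2 := Real.sq_sqrt (by norm_num)
  let F : ℝ → ℝ → ℝ := fun θ l =>
    2 * sin θ ^ 2 / ((3 - 2 * sin θ ^ 2) * (1 + l ^ 2 * (2 * sin θ ^ 2)))
  have e : ∀ θ, √2 * sin θ * arctan (√2 * sin θ) / (3 - 2 * sin θ ^ 2) =
      ∫ l in (0 : ℝ)..1, F θ l := by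
    intro θ
    rw [arctan_eq_intervalIntegral, mul_div_right_comm, ← intervalIntegral.integral_const_mul]
    congr 1
    ext l
    rw [div_mul_div_comm, ← pow_two, mul_pow, mul_pow, mul_pow, h2]
  have hF : Continuous F.uncurry := by
    refine Continuous.div (by fun_prop) (by fun_prop) fun x => ?_
    have hs : sin x.1 ^ 2 ≤ 1 := sin_sq_le_one _
    have : 0 < 3 - 2 * sin x.1 ^ 2 := by linarith
    positivity
  simp only [e]
  rw [intervalIntegral_intervalIntegral_swap]
  · simp only [F, integral_sin_sq_div, intervalIntegral.integral_const_mul,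
      integral_sqrt_three_div]
    ring
  · exact (hF.continuousOn.integrableOn_compact (isCompact_uIcc.prod isCompact_uIcc)).mono_set
      (Set.prod_mono Set.uIoc_subset_uIcc Set.uIoc_subset_uIcc)

lemma integral_mul_arctan_div_sqrt :
    ∫ t in (0 : ℝ)..√2, t * arctan t / ((3 - t ^ 2) * √(2 - t ^ 2)) = π ^ 2 / 12 := by
  have h2 : √2 ^ 2 = 2 := Real.sq_sqrt (by norm_num)
  have h20 : 0 < √2 := by positivity
  let h : ℝ → ℝ := fun θ => √2 * sin θ * arctan (√2 * sin θ) / (3 - 2 * sin θ ^ 2)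
  have hh : Continuous h := by
    refine Continuous.div (by fun_prop) (by fun_prop) fun x => ?_
    have hs : sin x ^ 2 ≤ 1 := sin_sq_le_one _
    have : 0 < 3 - 2 * sin x ^ 2 := by linarith
    positivity
  -- `G` encodes `t = √2 sin θ`. It is continuous up to the singular endpoint `√2`, and the
  -- nonnegativity of its derivative yields integrability there.
  let G : ℝ → ℝ := fun t => ∫ θ in (0 : ℝ)..arcsin (t / √2), h θ
  have hprim : ∀ x, HasDerivAt (fun x => ∫ θ in (0 : ℝ)..x, h θ) (h x) x := fun x =>
    intervalIntegral.integral_hasDerivAt_right (hh.intervalIntegrable _ _)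
      (hh.stronglyMeasurableAtFilter _ _) hh.continuousAt
  have hcont : Continuous G := by
    have : Continuous fun x => ∫ θ in (0 : ℝ)..x, h θ :=
      continuous_iff_continuousAt.2 fun x => (hprim x).continuousAt
    exact this.comp (continuous_arcsin.comp (continuous_id.div_const _))
  have hderiv : ∀ t ∈ Set.Ioo 0 √2,
      HasDerivAt G (t * arctan t / ((3 - t ^ 2) * √(2 - t ^ 2))) t := by
    rintro t ⟨ht0, ht⟩
    have hlt : t / √2 < 1 := (div_lt_one h20).2 ht
    have hpos : 0 < t / √2 := by positivity
    have ha := (hasDerivAt_arcsin (x := t / √2) (by linarith) hlt.ne).comp t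
      ((hasDerivAt_id t).div_const √2)
    refine ((hprim _).comp t ha).congr_deriv ?_
    have ht2 : 0 < 2 - t ^ 2 := by nlinarith
    have hsq : √(1 - (t / √2) ^ 2) = √(2 - t ^ 2) / √2 := by
      rw [div_pow, h2, ← Real.sqrt_div ht2.le]
      congr 1
      ring
    simp only [h, id, Function.comp_apply]
    rw [sin_arcsin (by linarith) hlt.le, hsq, mul_div_cancel₀ _ h20.ne', div_pow, h2]
    have : 0 < √(2 - t ^ 2) := by positivity
    have h3 : 3 - 2 * (t ^ 2 / 2) = 3 - t ^ 2 := by ring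
    rw [h3]
    field_simp
  have hnonneg : ∀ t ∈ Set.Ioo 0 √2, 0 ≤ t * arctan t / ((3 - t ^ 2) * √(2 - t ^ 2)) := by
    rintro t ⟨ht0, ht⟩
    have h3 : 0 ≤ 3 - t ^ 2 := by nlinarith
    have := Real.arctan_nonneg.2 ht0.le
    positivity
  have hint := intervalIntegral.integrableOn_deriv_of_nonneg hcont.continuousOn hderiv hnonneg
  rw [intervalIntegral.integral_eq_sub_of_hasDerivAt_of_le h20.le hcont.continuousOn hderiv
    ((intervalIntegrable_iff_integrableOn_Ioc_of_le h20.le).2 hint)]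
  simp only [G, div_self h20.ne', arcsin_one, zero_div, arcsin_zero,
    intervalIntegral.integral_same, sub_zero]
  exact integral_sin_mul_arctan

/-! ### Riemannian volume in the charts -/

/-- The linear embedding `x ↦ (x, 0)` of `ℝ³` into `ℝ⁴`. -/
noncomputable def embedCLM : E3 →L[ℝ] E4 :=
  LinearMap.toContinuousLinearMap
    { toFun := fun x => embed x 0
      map_add' := fun x y => by ext i; fin_cases i <;> simp [embed]
      map_smul' := fun c x => by simpa using embed_smul c x 0 }

lemma embedCLM_apply (x : E3) : embedCLM x = embed x 0 := rfl

lemma embed_eq_embedCLM_add (x : E3) (s : ℝ) : embed x s = embedCLM x + embed 0 s := by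
  ext i
  fin_cases i <;> simp [embed, embedCLM_apply]

section volume
variable {r : ℝ} (hr : 0 < r)
include hr

lemma hasFDerivAt_chartInv (x : E3) :
    HasFDerivAt (chartInv r)
      ((r / √(r ^ 2 + ‖x‖ ^ 2)) • embedCLM +
        ((-(r / √(r ^ 2 + ‖x‖ ^ 2) ^ 3)) • innerSL ℝ x).smulRight (embed x r)) x := by
  have hpos : 0 < r ^ 2 + ‖x‖ ^ 2 := by positivity
  have hs := sqrt_pos_of_radius hr x
  have h1 : HasFDerivAt (fun x : E3 => r ^ 2 + ‖x‖ ^ 2) (2 • innerSL ℝ x) x :=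
    (hasStrictFDerivAt_norm_sq x).hasFDerivAt.const_add _
  have h2 : HasDerivAt (fun s : ℝ => r / √s) (-(r / (2 * √(r ^ 2 + ‖x‖ ^ 2) ^ 3)))
      (r ^ 2 + ‖x‖ ^ 2) := by
    have := (hasDerivAt_const (r ^ 2 + ‖x‖ ^ 2) r).div (Real.hasDerivAt_sqrt hpos.ne') hs.ne'
    refine this.congr_deriv ?_
    field_simp
    ring
  have h3 := h2.comp_hasFDerivAt x h1
  have h4 : HasFDerivAt (fun x : E3 => embed x r) embedCLM x := by
    rw [funext fun x => embed_eq_embedCLM_add x r]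
    exact embedCLM.hasFDerivAt.add_const _
  refine (h3.smul h4).congr_fderiv ?_
  ext v i
  simp only [add_apply, smul_apply, ContinuousLinearMap.smulRight_apply, PiLp.add_apply,
    PiLp.smul_apply, smul_eq_mul, nsmul_eq_mul, Function.comp_apply]
  push_cast
  field_simp

lemma inner_fderiv_chartInv (x v w : E3) :
    inner ℝ (fderiv ℝ (chartInv r) x v) (fderiv ℝ (chartInv r) x w) =
      r ^ 2 / (r ^ 2 + ‖x‖ ^ 2) *
        (inner ℝ v w - inner ℝ x v * inner ℝ x w / (r ^ 2 + ‖x‖ ^ 2)) := by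
  have hs := sqrt_pos_of_radius hr x
  have hsq : √(r ^ 2 + ‖x‖ ^ 2) ^ 2 = r ^ 2 + ‖x‖ ^ 2 := Real.sq_sqrt (by positivity)
  rw [(hasFDerivAt_chartInv hr x).fderiv]
  simp only [add_apply, smul_apply,
    ContinuousLinearMap.smulRight_apply, innerSL_apply_apply, embedCLM_apply, inner_add_left,
    inner_add_right, inner_smul_left, inner_smul_right, inner_embed, conj_trivial, smul_eq_mul,
    real_inner_self_eq_norm_sq, norm_embed_sq]
  rw [real_inner_comm x v]
  generalize √(r ^ 2 + ‖x‖ ^ 2) = ρ at *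
  rw [← hsq]
  have hx : ‖x‖ ^ 2 = ρ ^ 2 - r ^ 2 := by linarith
  rw [hx]
  field_simp
  ring

/-- With `R² = r² + ‖x‖²` the metric is `(r²/R²)(I - x xᵀ/R²)`, of determinant `(r²/R²)³ (1 -
‖x‖²/R²) = r⁸/R⁸`. -/
lemma sqrt_abs_det_inducedMetric_chartInv (x : E3) :
    √|(inducedMetric (chartInv r) x).det| = r ^ 4 / (r ^ 2 + ‖x‖ ^ 2) ^ 2 := by
  have hpos : 0 < r ^ 2 + ‖x‖ ^ 2 := by positivity
  have hn : ‖x‖ ^ 2 = x 0 ^ 2 + x 1 ^ 2 + x 2 ^ 2 := by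
    rw [EuclideanSpace.real_norm_sq_eq, Fin.sum_univ_three]
  have hdet : (inducedMetric (chartInv r) x).det = (r ^ 4 / (r ^ 2 + ‖x‖ ^ 2) ^ 2) ^ 2 := by
    rw [Matrix.det_fin_three]
    simp only [inducedMetric, Matrix.of_apply, inner_fderiv_chartInv hr,
      EuclideanSpace.inner_single_right, PiLp.single_apply]
    simp
    field_simp
    rw [hn]
    ring
  rw [hdet, abs_of_nonneg (by positivity), Real.sqrt_sq (by positivity)]

omit hr in
lemma inducedMetric_neg (φ : E3 → E4) (x : E3) :
    inducedMetric (fun x => -φ x) x = inducedMetric φ x := by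
  ext A B
  simp [inducedMetric, fderiv_fun_neg]

omit hr in
/-- The Riemannian volume measure of `S³_r` in the central-projection chart. -/
noncomputable def chartMeasure (r : ℝ) : Measure E3 :=
  volume.withDensity fun x => ENNReal.ofReal (r ^ 4 / (r ^ 2 + ‖x‖ ^ 2) ^ 2)

lemma sphereVolume_eq (A : Set E4) :
    sphereVolume r A =
      chartMeasure r (chartInv r ⁻¹' A) + chartMeasure r ((fun x => -chartInv r x) ⁻¹' A) := by
  simp only [sphereVolume, paramVolume, inducedMetric_neg, sqrt_abs_det_inducedMetric_chartInv hr,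
    chartMeasure, withDensity_apply']

lemma integral_Ioi_radial :
    IntegrableOn (fun y : ℝ => y ^ 2 * (r ^ 4 / (r ^ 2 + y ^ 2) ^ 2)) (Set.Ioi 0) ∧
      ∫ y in Set.Ioi (0 : ℝ), y ^ 2 * (r ^ 4 / (r ^ 2 + y ^ 2) ^ 2) = π * r ^ 3 / 4 := by
  let g : ℝ → ℝ := fun y => r ^ 3 / 2 * arctan (y / r) - r ^ 4 / 2 * (y / (r ^ 2 + y ^ 2))
  have hd : ∀ y ∈ Set.Ici (0 : ℝ), HasDerivAt g (y ^ 2 * (r ^ 4 / (r ^ 2 + y ^ 2) ^ 2)) y := by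
    intro y _
    have hpos : 0 < r ^ 2 + y ^ 2 := by positivity
    have h1 := (((hasDerivAt_id y).div_const r).arctan).const_mul (r ^ 3 / 2)
    have h2 : HasDerivAt (fun y : ℝ => r ^ 2 + y ^ 2) (2 * y) y := by
      simpa using ((hasDerivAt_id y).pow 2).const_add (r ^ 2)
    have h3 := ((hasDerivAt_id y).div h2 hpos.ne').const_mul (r ^ 4 / 2)
    refine (h1.sub h3).congr_deriv ?_
    have h4 : 1 + (y / r) ^ 2 = (r ^ 2 + y ^ 2) / r ^ 2 := by field_simp
    simp only [id, h4]
    field_simp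
    ring
  have hnn : ∀ y ∈ Set.Ioi (0 : ℝ), 0 ≤ y ^ 2 * (r ^ 4 / (r ^ 2 + y ^ 2) ^ 2) :=
    fun y _ => by positivity
  have hlim : Tendsto g atTop (𝓝 (π * r ^ 3 / 4)) := by
    have h1 : Tendsto (fun y : ℝ => arctan (y / r)) atTop (𝓝 (π / 2)) :=
      (tendsto_arctan_atTop.mono_right nhdsWithin_le_nhds).comp
        (tendsto_id.atTop_div_const hr)
    have h2 : Tendsto (fun y : ℝ => y / (r ^ 2 + y ^ 2)) atTop (𝓝 0) := by
      refine squeeze_zero' (g := fun y : ℝ => y⁻¹) ?_ ?_ tendsto_inv_atTop_zero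
      · filter_upwards [eventually_ge_atTop 0] with y hy
        positivity
      · filter_upwards [eventually_gt_atTop 0] with y hy
        rw [div_le_iff₀ (by positivity), inv_mul_eq_div, le_div_iff₀ hy]
        nlinarith
    have := (h1.const_mul (r ^ 3 / 2)).sub (h2.const_mul (r ^ 4 / 2))
    convert this using 2
    ring
  refine ⟨integrableOn_Ioi_deriv_of_nonneg' hd hnn hlim, ?_⟩
  rw [integral_Ioi_of_hasDerivAt_of_nonneg' hd hnn hlim]
  simp [g]

/-- Polar coordinates: sphere area `4π` times the radial integral `πr³/4`. -/
lemma chartMeasure_univ : chartMeasure r Set.univ = ENNReal.ofReal (π ^ 2 * r ^ 3) := by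
  have hi := integral_Ioi_radial hr
  have hf : Module.finrank ℝ E3 = 3 := by simp
  have h1 : Integrable (fun x : E3 => r ^ 4 / (r ^ 2 + ‖x‖ ^ 2) ^ 2) := by
    rw [integrable_fun_norm_addHaar volume (f := fun y : ℝ => r ^ 4 / (r ^ 2 + y ^ 2) ^ 2), hf]
    exact hi.1
  have hb : (volume : Measure E3).real (Metric.ball 0 1) = π * 4 / 3 := by
    rw [Measure.real, EuclideanSpace.volume_ball_fin_three]
    simp
    positivity
  have h2 : ∫ x : E3, r ^ 4 / (r ^ 2 + ‖x‖ ^ 2) ^ 2 = π ^ 2 * r ^ 3 := by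
    rw [integral_fun_norm_addHaar volume (fun y : ℝ => r ^ 4 / (r ^ 2 + y ^ 2) ^ 2), hf, hb]
    simp only [smul_eq_mul]
    rw [hi.2]
    simp
    ring
  rw [chartMeasure, withDensity_apply', Measure.restrict_univ,
    ← ofReal_integral_eq_lintegral_ofReal h1 (ae_of_all _ fun x => by positivity), h2]

lemma volume_setOf_inner_embed_eq_zero {N : E4} (hN : N ≠ 0) :
    volume {x : E3 | inner ℝ N (embed x r) = 0} = 0 := by
  let P : AffineSubspace ℝ E3 :=
    { carrier := {x : E3 | inner ℝ N (embed x r) = 0}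
      smul_vsub_vadd_mem' := fun c x y z hx hy hz => by
        simp only [Set.mem_ofPred_eq, inner_embed_right] at hx hy hz ⊢
        simp
        linear_combination c * hx - c * hy + hz }
  have hP : P ≠ ⊤ := by
    intro h
    have hmem : ∀ x : E3, inner ℝ N (embed x r) = 0 := fun x => by
      have : x ∈ P := h ▸ AffineSubspace.mem_top ℝ E3 x
      exact this
    simp only [inner_embed_right] at hmem
    have h0 := hmem 0
    have h1 := hmem !₂[1, 0, 0]
    have h2 := hmem !₂[0, 1, 0]
    have h3 := hmem !₂[0, 0, 1]
    simp at h0 h1 h2 h3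
    have h4 : N 3 = 0 := h0.resolve_right hr.ne'
    simp only [h4, zero_mul, add_zero] at h1 h2 h3
    refine hN ?_
    ext i
    fin_cases i <;> simp_all
  exact Measure.addHaar_affineSubspace volume P hP

/-- The antipodal chart reverses the sign of `⟪N, ·⟫`, so the two preimages are complementary up to
a null set and their measures add up to one full chart. -/
lemma sphereVolume_halfSphere {N : E4} (hN : N ≠ 0) :
    sphereVolume r {x | x ∈ sphere3 r ∧ 0 ≤ inner ℝ N x} = ENNReal.ofReal (π ^ 2 * r ^ 3) := by
  have hcont : Continuous fun x : E3 => inner ℝ N (embed x r) := by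
    simp only [inner_embed_right]
    fun_prop
  have e1 : chartInv r ⁻¹' {x | x ∈ sphere3 r ∧ 0 ≤ inner ℝ N x} =
      {x | 0 ≤ inner ℝ N (embed x r)} := by
    ext x
    simp [chartInv_mem_sphere hr, inner_chartInv_nonneg_iff hr]
  have e2 : (fun x => -chartInv r x) ⁻¹' {x | x ∈ sphere3 r ∧ 0 ≤ inner ℝ N x} =
      {x | inner ℝ N (embed x r) ≤ 0} := by
    ext x
    have := inner_chartInv_nonneg_iff hr (-N) x
    simp only [inner_neg_left, Left.nonneg_neg_iff] at this
    simp [sphere3, norm_chartInv hr, this]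
  have e3 : ({x | inner ℝ N (embed x r) ≤ 0} : Set E3) =ᵐ[chartMeasure r]
      ({x | 0 ≤ inner ℝ N (embed x r)} : Set E3)ᶜ := by
    have hae : ∀ᵐ x ∂(chartMeasure r), inner ℝ N (embed x r) ≠ 0 := by
      refine (withDensity_absolutelyContinuous volume _).ae_le ?_
      refine ae_iff.2 ?_
      simpa using volume_setOf_inner_embed_eq_zero hr hN
    filter_upwards [hae] with x hx
    refine propext ?_
    change inner ℝ N (embed x r) ≤ 0 ↔ ¬ (0 ≤ inner ℝ N (embed x r))
    rw [not_le, le_iff_lt_or_eq, or_iff_left hx]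
  rw [sphereVolume_eq hr, e1, e2, measure_congr e3]
  exact (measure_add_measure_compl
    (measurableSet_le measurable_const hcont.measurable)).trans (chartMeasure_univ hr)

lemma sphereVolume_sphere3 : sphereVolume r (sphere3 r) = 2 * ENNReal.ofReal (π ^ 2 * r ^ 3) := by
  have e1 : chartInv r ⁻¹' sphere3 r = Set.univ :=
    Set.eq_univ_of_forall fun x => chartInv_mem_sphere hr x
  have e2 : (fun x => -chartInv r x) ⁻¹' sphere3 r = Set.univ :=
    Set.eq_univ_of_forall fun x => by simp [sphere3, norm_chartInv hr]
  rw [sphereVolume_eq hr, e1, e2, chartMeasure_univ hr, two_mul]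

/-- The fourth coordinate has opposite signs in the two charts, so only the first contributes. -/
lemma sphereVolume_image_chartInv (A : Set E3) :
    sphereVolume r (chartInv r '' A) = chartMeasure r A := by
  have e : (fun x => -chartInv r x) ⁻¹' (chartInv r '' A) = ∅ := by
    refine Set.eq_empty_of_forall_notMem ?_
    rintro x ⟨y, -, hy⟩
    have h3 := congrArg (fun X : E4 => X 3) hy
    have hx := mul_pos (chart_factor_pos hr x) hr
    have hy := mul_pos (chart_factor_pos hr y) hr
    simp only [chartInv_eq, embed, PiLp.neg_apply, PiLp.smul_apply, smul_eq_mul] at h3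
    simp at h3
    linarith
  rw [sphereVolume_eq hr, e, measure_empty, add_zero,
    Set.preimage_image_eq A (chartInv_injective hr)]

omit hr in
lemma euclideanVertex_eq_smul (a : ℝ) (i : Fin 4) :
    euclideanVertex a i = a • euclideanVertex 1 i := by
  ext k
  fin_cases i <;> fin_cases k <;> simp [euclideanVertex] <;> ring

lemma tendsto_sphereVolume :
    Tendsto (fun a : ℝ => sphereVolume r (chartInv r '' euclideanTetrahedron a)) atTop
      (𝓝 (ENNReal.ofReal (π ^ 2 * r ^ 3))) := by
  -- Dividing the face inequalities by `a` leaves normals independent of `a`, so the family is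
  -- visibly increasing.
  let s : ℝ → Set E3 := fun a => {x | ∀ i, 0 ≤ inner ℝ (euclideanVertex 1 i) x + a / 8}
  have hs : ∀ a, 0 < a → euclideanTetrahedron a = s a := by
    intro a ha
    ext x
    rw [mem_euclideanTetrahedron_iff ha]
    refine forall_congr' fun i => ?_
    rw [euclideanVertex_eq_smul, inner_smul_left, conj_trivial,
      show a * inner ℝ (euclideanVertex 1 i) x + a ^ 2 / 8 =
        a * (inner ℝ (euclideanVertex 1 i) x + a / 8) by ring, mul_nonneg_iff_of_pos_left ha]
  have hmono : Monotone s := fun a b hab x hx i => (hx i).trans (by gcongr)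
  have hunion : ⋃ a, s a = Set.univ := by
    refine Set.eq_univ_of_forall fun x => Set.mem_iUnion.2
      ⟨8 * ∑ i, |inner ℝ (euclideanVertex 1 i) x|, fun i => ?_⟩
    have h1 := Finset.single_le_sum (f := fun i => |inner ℝ (euclideanVertex 1 i) x|)
      (fun i _ => abs_nonneg _) (Finset.mem_univ i)
    have h2 := neg_abs_le (inner ℝ (euclideanVertex 1 i) x)
    linarith
  have := tendsto_measure_iUnion_atTop (μ := chartMeasure r) hmono
  rw [hunion, chartMeasure_univ hr] at this
  refine this.congr' ?_
  filter_upwards [eventually_gt_atTop 0] with a ha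
  rw [sphereVolume_image_chartInv hr, hs a ha, Function.comp_apply]

end volume

/-! ### The main theorem -/

theorem mainTheorem3 (r : ℝ) (hr : 0 < r) :
    -- `a_max` is the maximal edge length of a regular geodesic tetrahedron in `S³_r`
    IsGreatest {a : ℝ | ∃ (v : Fin 4 → E4) (T : Set E4), IsRegularGeodesicTetrahedron r a v T}
      (maxEdge r) ∧
    -- it is the limit, as `a₀ → ∞`, of the edges of the geodesic tetrahedra with chart image `T(a₀)`
    (∀ a₀ : ℝ, 0 < a₀ →
      IsRegularGeodesicTetrahedron r (geodesicEdge r a₀)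
        (fun i => chartInv r (euclideanVertex a₀ i)) (chartInv r '' euclideanTetrahedron a₀)) ∧
    Tendsto (geodesicEdge r) atTop (𝓝 (maxEdge r)) ∧
    -- every regular tetrahedron with edge `a_max` has volume `π² r³`, half the volume of `S³_r`
    (∀ (v : Fin 4 → E4) (T : Set E4), IsRegularGeodesicTetrahedron r (maxEdge r) v T →
      sphereVolume r T = ENNReal.ofReal (π ^ 2 * r ^ 3) ∧
      sphereVolume r T = sphereVolume r (sphere3 r) / 2) ∧
    -- this is also the limit, as `a₀ → ∞`, of the volumes of those geodesic tetrahedra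
    Tendsto (fun a₀ : ℝ => sphereVolume r (chartInv r '' euclideanTetrahedron a₀)) atTop
      (𝓝 (ENNReal.ofReal (π ^ 2 * r ^ 3))) ∧
    -- and the value at `a = a_max` of the integral expression for the volume `V(r, a)`
    12 * r ^ 3 * (∫ t in (0 : ℝ)..tan (maxEdge r / (2 * r)),
      t * arctan t / ((3 - t ^ 2) * √(2 - t ^ 2))) = π ^ 2 * r ^ 3 := by
  refine ⟨isGreatest_maxEdge hr, fun a₀ ha₀ => isRegularGeodesicTetrahedron_chartInv hr ha₀,
    tendsto_geodesicEdge hr, fun v T h => ?_, tendsto_sphereVolume hr, ?_⟩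
  · obtain ⟨N, hN, rfl⟩ := h.eq_halfSphere hr
    have hV := sphereVolume_halfSphere hr hN
    refine ⟨hV, ?_⟩
    rw [hV, sphereVolume_sphere3 hr, mul_comm 2,
      ENNReal.mul_div_cancel_right two_ne_zero ENNReal.ofNat_ne_top]
  · have ht : tan (maxEdge r / (2 * r)) = √2 := by
      rw [maxEdge, show 2 * arctan √2 * r / (2 * r) = arctan √2 by field_simp, tan_arctan]
    rw [ht, integral_mul_arctan_div_sqrt]
    ring
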